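/- For each sample size $n$ let $p=p_n$ be the number of explanatory variables and $k=k_n$ the change-point, with $k_n/n\to\theta^0\in(0,1)$. Let $\mathbf X_1,\dots,\mathbf X_n\in\mathbb R^{p}$ be a deterministic design (which may depend on $n$), let $\varepsilon_1,\varepsilon_2,\dots$ be i.i.d. random variables with mean zero and finite variance $\sigma^2$, and let $$Y_i=\mathbf X_i^t\boldsymbol\beta^0+\varepsilon_i\quad(1\le i\le k),\qquad Y_i=\mathbf X_i^t\boldsymbol\beta_2^0+\varepsilon_i\quad(k<i\le n),$$ where under the null hypothesis $H_0$ one has $\boldsymbol\beta_2^0=\boldsymbol\beta^0$. Put $\mathbf z_i(\boldsymbol\beta)=\mathbf X_i(Y_i-\mathbf X_i^t\boldsymbol\beta)$, $\mathbf z_i^0=\mathbf X_i\varepsilon_i$, $\theta=k/n$ and $$\mathbf V_n^0=\frac1{n\theta^2}\sum_{i=1}^k \mathrm{Var}(\mathbf z_i^0)+\frac1{n(1-\theta)^2}\sum_{j=k+1}^n\mathrm{Var}(\mathbf z_j^0),\qquad \mathrm{Var}(\mathbf z_i^0)=\sigma^2\mathbf X_i\mathbf X_i^t .$$ A Lagrange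 multiplier is a vector $\boldsymbol\lambda\in\mathbb R^p$ with $k/n+\boldsymbol\lambda^t\mathbf z_i(\boldsymbol\beta^0)>0$ for $1\le i\le k$, $1-k/n-\boldsymbol\lambda^t\mathbf z_j(\boldsymbol\beta^0)>0$ for $k<j\le n$ (positivity of the corresponding empirical probabilities) and $$\sum_{i=1}^k\frac{\mathbf z_i(\boldsymbol\beta^0)}{k/n+\boldsymbol\lambda^t\mathbf z_i(\boldsymbol\beta^0)}-\sum_{j=k+1}^n\frac{\mathbf z_j(\boldsymbol\beta^0)}{1-k/n-\boldsymbol\lambda^t\mathbf z_j(\boldsymbol\beta^0)}=\mathbf 0_p .$$ Suppose that $H_0$ holds and that, for some real constant $q\ge 4$: (A1) there are constants $C_0,C_1>0$ such that for all sufficiently large $n$ every eigenvalue of $\mathbf V_n^0$ lies in $(C_0,C_1)$; (A3) there is $C_3>0$ with $p^{-1}\sum_{s=1}^p|X_{i,s}|^q<C_3$ for all $n$ and all $1\le i\le n$; (A4) $\mathbb E|\varepsilon_1|^{2q}<C_4$ for some $C_4>0$; (A5) $p\,k^{(2-q)/(2q)}\to0$ and $p\,(n-k)^{(2-q)/(2q)}\to0$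 as $n\to\infty$; (A6) $p^{2+4/q}k^{-1}\to0$ and $p^{2+4/q}(n-k)^{-1}\to0$ as $n\to\infty$. Then, with probability tending to one as $n\to\infty$, the Lagrange multiplier $\boldsymbol\lambda=\boldsymbol\lambda_n$ exists and is unique, and $\|\boldsymbol\lambda\|=O_{\mathbb P}(p^{1/2}n^{-1/2})$, whatever value $\boldsymbol\lambda$ is given where no Lagrange multiplier exists. That is, for every $\delta>0$ there is $M>0$ such that $\mathbb P(\|\boldsymbol\lambda_n\|>M p^{1/2}n^{-1/2})\le\delta$ for all sufficiently large $n$ ($\|\cdot\|$ is the Euclidean norm). -/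

import Mathlib

open MeasureTheory ProbabilityTheory Filter Topology

noncomputable section

namespace TwoSampleEL

/-!
Conventions. For every sample size `n` there are `n` observations, indexed by `i = 0, …, n - 1`;
the first phase consists of `i < k` and the second one of `k ≤ i < n`, where `k = k n` is the
change-point. The number of explanatory variables is `p = p n`, and the (deterministic) design
vectors `X n i` are elements of `ℝ ^ (p n)`. -/

/-- The response variable in the two-phase linear model with change-point `k`, design `X`,
coefficients `β` (first phase) and `β₂` (second phase), and errors `ε`. -/
def response {d : ℕ} (k : ℕ) (X : ℕ → EuclideanSpace ℝ (Fin d))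
    (β β₂ : EuclideanSpace ℝ (Fin d)) (ε : ℕ → ℝ) (i : ℕ) : ℝ :=
  if i < k then inner ℝ (X i) β + ε i else inner ℝ (X i) β₂ + ε i

/-- The vectors `z_i(β) = X_i (Y_i - X_iᵗ β)`. -/
def zVec {d : ℕ} (X : ℕ → EuclideanSpace ℝ (Fin d)) (Y : ℕ → ℝ)
    (β : EuclideanSpace ℝ (Fin d)) (i : ℕ) : EuclideanSpace ℝ (Fin d) :=
  (Y i - inner ℝ (X i) β) • X i

/-- The vectors `z_i⁰ = X_i ε_i`. -/
def zZero {d : ℕ} (X : ℕ → EuclideanSpace ℝ (Fin d)) (ε : ℕ → ℝ) (i : ℕ) :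
    EuclideanSpace ℝ (Fin d) :=
  ε i • X i

/-- `l` is a Lagrange multiplier of the two-sample empirical likelihood for the vectors
`z_0, …, z_{n-1}` and the change-point `k`: the empirical probabilities
`1 / (k + n lᵗ z_i)`, `i < k`, and `1 / (n - k - n lᵗ z_j)`, `k ≤ j < n`, are positive, and `l`
solves the score equation
`∑_{i < k} z_i / (k/n + lᵗ z_i) - ∑_{k ≤ j < n} z_j / (1 - k/n - lᵗ z_j) = 0`. -/
def IsLagrangeMultiplier {d : ℕ} (n k : ℕ) (z : ℕ → EuclideanSpace ℝ (Fin d))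
    (l : EuclideanSpace ℝ (Fin d)) : Prop :=
  (∀ i ∈ Finset.range k, 0 < (k : ℝ) / n + inner ℝ l (z i)) ∧
  (∀ j ∈ Finset.Ico k n, 0 < 1 - (k : ℝ) / n - inner ℝ l (z j)) ∧
  ∑ i ∈ Finset.range k, ((k : ℝ) / n + inner ℝ l (z i))⁻¹ • z i
    - ∑ j ∈ Finset.Ico k n, (1 - (k : ℝ) / n - inner ℝ l (z j))⁻¹ • z j = 0

/-- The covariance matrix of a random vector. -/
def covMatrix {Ω : Type*} [MeasurableSpace Ω] (P : Measure Ω) {d : ℕ}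
    (Z : Ω → EuclideanSpace ℝ (Fin d)) : Matrix (Fin d) (Fin d) ℝ :=
  Matrix.of fun s t => cov[fun ω => Z ω s, fun ω => Z ω t; P]

/-- The matrix `V_n⁰ = (n θ²)⁻¹ ∑_{i < k} Var(z_i⁰) + (n (1 - θ)²)⁻¹ ∑_{k ≤ j < n} Var(z_j⁰)`,
where `θ = k / n`. -/
def VZero {Ω : Type*} [MeasurableSpace Ω] (P : Measure Ω) {d : ℕ} (n k : ℕ)
    (X : ℕ → EuclideanSpace ℝ (Fin d)) (ε : ℕ → Ω → ℝ) : Matrix (Fin d) (Fin d) ℝ :=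
  ((n : ℝ) * ((k : ℝ) / n) ^ 2)⁻¹ •
      ∑ i ∈ Finset.range k, covMatrix P (fun ω => zZero X (fun m => ε m ω) i)
    + ((n : ℝ) * (1 - (k : ℝ) / n) ^ 2)⁻¹ •
      ∑ j ∈ Finset.Ico k n, covMatrix P (fun ω => zZero X (fun m => ε m ω) j)

/-- The errors are independent and identically distributed with mean zero and finite variance. -/
structure IIDErrors {Ω : Type*} [MeasurableSpace Ω] (P : Measure Ω) (ε : ℕ → Ω → ℝ) : Prop where
  indep : iIndepFun ε P
  identDistrib : ∀ i, IdentDistrib (ε i) (ε 0) P P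
  finite_variance : MemLp (ε 0) 2 P
  mean_zero : ∫ ω, ε 0 ω ∂P = 0

/-- Eigenvalue condition: for all large `n` (so that `0 < k < n` and `V_n⁰` makes sense), all the
eigenvalues of the symmetric matrix `V_n⁰` lie between two positive constants. -/
def AssumptionA1 {Ω : Type*} [MeasurableSpace Ω] (P : Measure Ω) (p k : ℕ → ℕ)
    (X : (n : ℕ) → ℕ → EuclideanSpace ℝ (Fin (p n))) (ε : ℕ → Ω → ℝ) : Prop :=
  ∃ C₀ C₁ : ℝ, 0 < C₀ ∧ 0 < C₁ ∧ ∀ᶠ n in atTop,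
    ∀ γ ∈ spectrum ℝ (VZero P n (k n) (X n) ε), C₀ < γ ∧ γ < C₁

/-- Design condition: `p⁻¹ ∑_s |X_{i,s}| ^ q < C₃` for all `n` and all `i < n`. -/
def AssumptionA3 (q : ℝ) (p : ℕ → ℕ)
    (X : (n : ℕ) → ℕ → EuclideanSpace ℝ (Fin (p n))) : Prop :=
  ∃ C₃ : ℝ, 0 < C₃ ∧ ∀ n, ∀ i < n, ((p n : ℝ))⁻¹ * ∑ s, |X n i s| ^ q < C₃

/-- Moment condition: `E |ε| ^ (2 q) < C₄`. -/
def AssumptionA4 {Ω : Type*} [MeasurableSpace Ω] (P : Measure Ω) (q : ℝ)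
    (ε : ℕ → Ω → ℝ) : Prop :=
  ∃ C₄ : ℝ, 0 < C₄ ∧ ∫⁻ ω, ENNReal.ofReal (|ε 0 ω| ^ (2 * q)) ∂P < ENNReal.ofReal C₄

/-- Growth condition: `p k ^ ((2 - q) / (2 q)) → 0` and `p (n - k) ^ ((2 - q) / (2 q)) → 0`. -/
def AssumptionA5 (q : ℝ) (p k : ℕ → ℕ) : Prop :=
  Tendsto (fun n => (p n : ℝ) * (k n : ℝ) ^ ((2 - q) / (2 * q))) atTop (𝓝 0) ∧
  Tendsto (fun n : ℕ => (p n : ℝ) * ((n : ℝ) - k n) ^ ((2 - q) / (2 * q))) atTop (𝓝 0)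

/-- Growth condition: `p ^ (2 + 4 / q) / k → 0` and `p ^ (2 + 4 / q) / (n - k) → 0`. -/
def AssumptionA6 (q : ℝ) (p k : ℕ → ℕ) : Prop :=
  Tendsto (fun n => (p n : ℝ) ^ (2 + 4 / q) * ((k n : ℝ))⁻¹) atTop (𝓝 0) ∧
  Tendsto (fun n : ℕ => (p n : ℝ) ^ (2 + 4 / q) * ((n : ℝ) - k n)⁻¹) atTop (𝓝 0)

/-- `Z_n = O_P(r_n)`: for every `δ > 0` there is `M` with `P(|Z_n| > M r_n) ≤ δ` for all
large `n`. (`P` is applied as an outer measure, so that no measurability is needed.) -/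
def IsBigOInProbability {Ω : Type*} [MeasurableSpace Ω] (P : Measure Ω) (Z : ℕ → Ω → ℝ)
    (r : ℕ → ℝ) : Prop :=
  ∀ δ : ℝ, 0 < δ → ∃ M : ℝ, 0 < M ∧ ∀ᶠ n in atTop,
    P {ω | M * r n < |Z n ω|} ≤ ENNReal.ofReal δ

end TwoSampleEL

end

/-! Flip the sign of the vectors of the second phase: with `y i = ± z i` and `t i` equal to `k/n` or
`1 - k/n`, a Lagrange multiplier is a zero, inside the domain of positivity, of the gradient of the
concave function `F l = ∑ log (t i + ⟪l, y i⟫)`. Such a zero is unique as soon as the quadratic form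
`∑ ⟪u, y i⟫ ^ 2` is definite (`score_zero_unique`). For existence with the right size, `F` is
maximized over the closed ball of radius `r = M √(p/n)`. If the gradient points inward on the
sphere, the maximum is interior, hence a zero of the gradient (`exists_score_zero`). This needs
three bounds: `r ‖y i‖ ≤ a/2`, which keeps the logarithms away from their singularity; `∑ ⟪u, y i⟫ ^
2 ≥ c n ‖u‖ ^ 2`; and a gradient at `0` of norm below `c n r / 2`. Under the null hypothesis `z i =
ε i • X i`, with `‖X i‖ ^ 2 = O(p)` by (A3), so each bound can be checked outside a small event. The
largest error is handled by a union bound and the moment of order `q`, which is where (A5) enters.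
The gradient at `0` has second moment of order `n p`, so Chebyshev gives a probability of order
`M⁻²`, small when `M` is large. For the quadratic form, (A1) bounds its mean below, and its
fluctuation is controlled in the Hilbert–Schmidt norm of `∑ (ε i ^ 2 - σ²) X i ⊗ X i`, with failure
probability `O(p ^ 2 / n)`, which vanishes by (A6). -/

namespace TwoSampleEL

/-! ### Zeros of a deterministic score in a ball. -/

section Deterministic

variable {E : Type*} [NormedAddCommGroup E] [InnerProductSpace ℝ E] {ι : Type*}

/-- The score `∑ (t_i + ⟪l, y_i⟫)⁻¹ y_i` has at most one zero if the `y_i` span. -/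
lemma score_zero_unique (s : Finset ι) (y : ι → E) (t : ι → ℝ) {c : ℝ} (hc : 0 < c)
    (hspan : ∀ u : E, c * ‖u‖ ^ 2 ≤ ∑ i ∈ s, inner ℝ u (y i) ^ 2) {l m : E}
    (hl : ∀ i ∈ s, 0 < t i + inner ℝ l (y i)) (hm : ∀ i ∈ s, 0 < t i + inner ℝ m (y i))
    (hl0 : ∑ i ∈ s, (t i + inner ℝ l (y i))⁻¹ • y i = 0)
    (hm0 : ∑ i ∈ s, (t i + inner ℝ m (y i))⁻¹ • y i = 0) : l = m := by
  -- Strict monotonicity of the gradient: pairing the difference of the two scores with `m - l`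
  -- gives a sum of squares with positive weights.
  have hsum : ∑ i ∈ s, inner ℝ (m - l) (y i) ^ 2 *
      ((t i + inner ℝ l (y i))⁻¹ * (t i + inner ℝ m (y i))⁻¹) = 0 := by
    have h : inner ℝ (m - l) (∑ i ∈ s, (t i + inner ℝ l (y i))⁻¹ • y i
        - ∑ i ∈ s, (t i + inner ℝ m (y i))⁻¹ • y i) = (0 : ℝ) := by
      rw [hl0, hm0, sub_zero, inner_zero_right]
    rw [← h, ← Finset.sum_sub_distrib, inner_sum]
    refine Finset.sum_congr rfl fun i hi => ?_
    have h1 := hl i hi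
    have h2 := hm i hi
    rw [← sub_smul, inner_smul_right, inner_sub_left]
    field_simp
    ring
  have hz : ∀ i ∈ s, inner ℝ (m - l) (y i) ^ 2 = 0 := by
    intro i hi
    have := (Finset.sum_eq_zero_iff_of_nonneg (fun i hi => mul_nonneg (sq_nonneg _)
      (mul_pos (inv_pos.2 (hl i hi)) (inv_pos.2 (hm i hi))).le)).1 hsum i hi
    exact (mul_eq_zero.1 this).resolve_right
      (mul_pos (inv_pos.2 (hl i hi)) (inv_pos.2 (hm i hi))).ne'
  have h := hspan (m - l)
  rw [Finset.sum_eq_zero hz] at h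
  have h0 : ‖m - l‖ ^ 2 = 0 := le_antisymm (by nlinarith) (sq_nonneg _)
  exact (sub_eq_zero.1 (norm_eq_zero.1 (pow_eq_zero_iff two_ne_zero |>.1 h0))).symm

variable (s : Finset ι) (y : ι → E) (t : ι → ℝ) {a c r B : ℝ}

lemma half_le_add_inner (hta : ∀ i ∈ s, a ≤ t i) (hsmall : ∀ i ∈ s, r * ‖y i‖ ≤ a / 2) {l : E}
    (hl : ‖l‖ ≤ r) {i : ι} (hi : i ∈ s) :
    a / 2 ≤ t i + inner ℝ l (y i) ∧ inner ℝ l (y i) ≤ a / 2 := by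
  have h1 := abs_le.1 (abs_real_inner_le_norm l (y i))
  have h2 : ‖l‖ * ‖y i‖ ≤ r * ‖y i‖ := mul_le_mul_of_nonneg_right hl (norm_nonneg _)
  have h3 := hsmall i hi
  have h4 := hta i hi
  constructor <;> linarith

/-- With `x = ⟪l, y i⟫`, each term satisfies `x / (t + x) ≤ x / t - x ^ 2 / 2`. Summing, the pairing
of the score with `l` is at most `r B - c r ^ 2 / 2 < 0`: curvature beats the score at zero. -/
lemma inner_score_neg (ha : 0 < a) (hta : ∀ i ∈ s, a ≤ t i) (ht1 : ∀ i ∈ s, t i ≤ 1)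
    (hsmall : ∀ i ∈ s, r * ‖y i‖ ≤ a / 2)
    (hB : ‖∑ i ∈ s, (t i)⁻¹ • y i‖ ≤ B)
    (hspan : ∀ u : E, c * ‖u‖ ^ 2 ≤ ∑ i ∈ s, inner ℝ u (y i) ^ 2)
    (hr : 0 < r) (hBr : 2 * B < c * r) {l : E} (hl : ‖l‖ = r) :
    inner ℝ (∑ i ∈ s, (t i + inner ℝ l (y i))⁻¹ • y i) l < (0 : ℝ) := by
  have hterm : ∀ i ∈ s, (t i + inner ℝ l (y i))⁻¹ * inner ℝ l (y i) ≤
      (t i)⁻¹ * inner ℝ l (y i) - inner ℝ l (y i) ^ 2 / 2 := by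
    intro i hi
    obtain ⟨h1, h2⟩ := half_le_add_inner s y t hta hsmall hl.le hi
    have h3 := hta i hi
    have h4 := ht1 i hi
    set x : ℝ := inner ℝ l (y i)
    have ht : 0 < t i := by linarith
    have htx : 0 < t i + x := by linarith
    -- Here `t i ≤ 1`, and `x ≤ a / 2 ≤ 1 / 2` gives `t i + x ≤ 3 / 2`.
    have hle : t i * (t i + x) ≤ 2 := by nlinarith
    have hpos : 0 < t i * (t i + x) := mul_pos ht htx
    have e : (t i)⁻¹ * x - (t i + x)⁻¹ * x = x ^ 2 / (t i * (t i + x)) := by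
      field_simp
      ring
    have : x ^ 2 / 2 ≤ x ^ 2 / (t i * (t i + x)) :=
      div_le_div_of_nonneg_left (sq_nonneg x) hpos hle
    linarith
  have e1 : inner ℝ (∑ i ∈ s, (t i + inner ℝ l (y i))⁻¹ • y i) l
      = ∑ i ∈ s, (t i + inner ℝ l (y i))⁻¹ * inner ℝ l (y i) := by
    rw [real_inner_comm, inner_sum]
    simp only [inner_smul_right]
  have e2 : ∑ i ∈ s, (t i)⁻¹ * inner ℝ l (y i) = inner ℝ l (∑ i ∈ s, (t i)⁻¹ • y i) := by
    rw [inner_sum]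
    simp only [inner_smul_right]
  have h5 := Finset.sum_le_sum hterm
  rw [Finset.sum_sub_distrib, e2, ← Finset.sum_div] at h5
  have h6 := real_inner_le_norm l (∑ i ∈ s, (t i)⁻¹ • y i)
  have h7 := hspan l
  rw [hl] at h6 h7
  have h8 : r * ‖∑ i ∈ s, (t i)⁻¹ • y i‖ ≤ r * B := mul_le_mul_of_nonneg_left hB hr.le
  rw [e1]
  nlinarith

/-- Identifies the score as a gradient, so that its zeros can be found by maximization. -/
lemma hasFDerivAt_sum_log {l : E} (hl : ∀ i ∈ s, 0 < t i + inner ℝ l (y i)) :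
    HasFDerivAt (fun l : E => ∑ i ∈ s, Real.log (t i + inner ℝ l (y i)))
      (innerSL ℝ (∑ i ∈ s, (t i + inner ℝ l (y i))⁻¹ • y i)) l := by
  rw [map_sum]
  refine HasFDerivAt.fun_sum fun i hi => ?_
  rw [map_smul]
  refine HasFDerivAt.log ?_ (hl i hi).ne'
  refine HasFDerivAt.const_add _ ?_
  have h := (innerSL ℝ (y i)).hasFDerivAt (x := l)
  refine h.congr_of_eventuallyEq (Eventually.of_forall fun m => ?_)
  simp [real_inner_comm]

/-- Existence of a zero of the score in a ball, if it points inward on the sphere. -/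
lemma exists_score_zero [FiniteDimensional ℝ E]
    (ha : 0 < a) (hta : ∀ i ∈ s, a ≤ t i) (ht1 : ∀ i ∈ s, t i ≤ 1)
    (hsmall : ∀ i ∈ s, r * ‖y i‖ ≤ a / 2)
    (hB : ‖∑ i ∈ s, (t i)⁻¹ • y i‖ ≤ B)
    (hspan : ∀ u : E, c * ‖u‖ ^ 2 ≤ ∑ i ∈ s, inner ℝ u (y i) ^ 2)
    (hr : 0 < r) (hBr : 2 * B < c * r) :
    ∃ l : E, ‖l‖ ≤ r ∧ (∀ i ∈ s, 0 < t i + inner ℝ l (y i)) ∧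
      ∑ i ∈ s, (t i + inner ℝ l (y i))⁻¹ • y i = 0 := by
  have : ProperSpace E := FiniteDimensional.proper ℝ E
  have hpos : ∀ l : E, ‖l‖ ≤ r → ∀ i ∈ s, 0 < t i + inner ℝ l (y i) := fun l hl i hi => by
    have := (half_le_add_inner s y t hta hsmall hl hi).1
    linarith
  set F : E → ℝ := fun l => ∑ i ∈ s, Real.log (t i + inner ℝ l (y i))
  have hcont : ContinuousOn F (Metric.closedBall 0 r) := fun l hl =>
    (hasFDerivAt_sum_log s y t (hpos l (by simpa using hl))).continuousAt.continuousWithinAt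
  obtain ⟨l, hlr, hmax⟩ := (isCompact_closedBall (0 : E) r).exists_isMaxOn
    ⟨0, Metric.mem_closedBall_self hr.le⟩ hcont
  have hl : ‖l‖ ≤ r := by simpa using hlr
  have hd := hasFDerivAt_sum_log s y t (hpos l hl)
  refine ⟨l, hl, hpos l hl, ?_⟩
  have hlt : ‖l‖ < r := by
    refine lt_of_le_of_ne hl fun heq => ?_
    have hneg := inner_score_neg s y t ha hta ht1 hsmall hB hspan hr hBr heq
    have hseg : segment ℝ l 0 ⊆ Metric.closedBall (0 : E) r :=
      (convex_closedBall (0 : E) r).segment_subset hlr (Metric.mem_closedBall_self hr.le)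
    -- At a maximum on the sphere, the derivative towards the centre, i.e. in the direction `-l`,
    -- would be nonpositive, but it is minus a negative number.
    have h := hmax.localize.hasFDerivWithinAt_nonpos hd.hasFDerivWithinAt
      (sub_mem_posTangentConeAt_of_segment_subset hseg)
    simp only [zero_sub, map_neg, innerSL_apply_apply] at h
    linarith
  have hloc : IsLocalMax F l := hmax.isLocalMax
    (Filter.mem_of_superset (Metric.isOpen_ball.mem_nhds (by simpa using hlt))
      Metric.ball_subset_closedBall)
  have h0 := hloc.hasFDerivAt_eq_zero hd
  -- Evaluating the vanishing derivative at the score itself gives the squared norm of the score.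
  have h1 := congrArg (fun f : E →L[ℝ] ℝ => f (∑ i ∈ s, (t i + inner ℝ l (y i))⁻¹ • y i)) h0
  simpa only [innerSL_apply_apply, zero_apply,
    inner_self_eq_zero] using h1

end Deterministic

end TwoSampleEL

/-! ### Moment and tail bounds for the errors. -/

namespace TwoSampleEL

variable {Ω : Type*} [MeasurableSpace Ω] {P : Measure Ω}

/-- Chebyshev's inequality for a weighted sum of uncorrelated variables, with weights in an
inner product space. -/
lemma measure_norm_sum_smul_gt_le [IsFiniteMeasure P] {H : Type*} [NormedAddCommGroup H]
    [InnerProductSpace ℝ H] {ι : Type*} (s : Finset ι) (ξ : ι → Ω → ℝ) (v : ι → H)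
    {τ t : ℝ} (hL2 : ∀ i, MemLp (ξ i) 2 P) (hτ : ∀ i, ∫ ω, ξ i ω * ξ i ω ∂P = τ)
    (hunc : ∀ i j, i ≠ j → ∫ ω, ξ i ω * ξ j ω ∂P = 0) (ht : 0 < t) :
    P {ω | t < ‖∑ i ∈ s, ξ i ω • v i‖} ≤
      ENNReal.ofReal (τ * (∑ i ∈ s, ‖v i‖ ^ 2) / t ^ 2) := by
  classical
  have hexp : ∀ ω, ‖∑ i ∈ s, ξ i ω • v i‖ ^ 2
      = ∑ i ∈ s, ∑ j ∈ s, (ξ i ω * ξ j ω) * inner ℝ (v i) (v j) := by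
    intro ω
    rw [← real_inner_self_eq_norm_sq, sum_inner]
    refine Finset.sum_congr rfl fun i _ => ?_
    rw [inner_sum]
    refine Finset.sum_congr rfl fun j _ => ?_
    rw [real_inner_smul_left, real_inner_smul_right, mul_assoc]
  have hint : ∀ i j, Integrable (fun ω => (ξ i ω * ξ j ω) * inner ℝ (v i) (v j)) P :=
    fun i j => ((hL2 i).integrable_mul (hL2 j)).mul_const _
  have hI : ∫ ω, ‖∑ i ∈ s, ξ i ω • v i‖ ^ 2 ∂P = τ * ∑ i ∈ s, ‖v i‖ ^ 2 := by
    simp_rw [hexp]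
    rw [integral_finsetSum _ fun i _ => integrable_finsetSum _ fun j _ => hint i j,
      Finset.mul_sum]
    refine Finset.sum_congr rfl fun i hi => ?_
    rw [integral_finsetSum _ fun j _ => hint i j, Finset.sum_eq_single i]
    · rw [integral_mul_const, hτ, real_inner_self_eq_norm_sq]
    · intro j _ hji
      rw [integral_mul_const, hunc i j hji.symm, zero_mul]
    · exact fun h => absurd hi h
  have hInt : Integrable (fun ω => ‖∑ i ∈ s, ξ i ω • v i‖ ^ 2) P := by
    simp_rw [hexp]
    exact integrable_finsetSum _ fun i _ => integrable_finsetSum _ fun j _ => hint i j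
  have hM := mul_meas_ge_le_integral_of_nonneg
    (Eventually.of_forall fun ω => sq_nonneg ‖∑ i ∈ s, ξ i ω • v i‖) hInt (t ^ 2)
  rw [hI] at hM
  have ht2 : 0 < t ^ 2 := by positivity
  calc P {ω | t < ‖∑ i ∈ s, ξ i ω • v i‖}
      ≤ P {ω | t ^ 2 ≤ ‖∑ i ∈ s, ξ i ω • v i‖ ^ 2} :=
        by
        refine measure_mono fun ω hω => ?_
        simp only [Set.mem_ofPred_eq] at hω ⊢
        exact pow_le_pow_left₀ ht.le hω.le 2
    _ = ENNReal.ofReal (P.real {ω | t ^ 2 ≤ ‖∑ i ∈ s, ξ i ω • v i‖ ^ 2}) := by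
        rw [ofReal_measureReal]
    _ ≤ _ := ENNReal.ofReal_le_ofReal (by rw [le_div_iff₀ ht2, mul_comm]; exact hM)

section Errors

variable {ε : ℕ → Ω → ℝ} {q : ℝ}

lemma memLp_of_assumptionA4 (hq : 4 ≤ q) (hε : IIDErrors P ε) (h4 : AssumptionA4 P q ε) :
    MemLp (ε 0) (ENNReal.ofReal (2 * q)) P := by
  obtain ⟨C, -, hC⟩ := h4
  refine ⟨hε.finite_variance.1, ?_⟩
  rw [eLpNorm_lt_top_iff_lintegral_rpow_enorm_lt_top (by simp; linarith) ENNReal.ofReal_ne_top,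
    ENNReal.toReal_ofReal (by linarith)]
  refine lt_of_le_of_lt (le_of_eq ?_) (hC.trans ENNReal.ofReal_lt_top)
  refine lintegral_congr fun ω => ?_
  rw [Real.enorm_eq_ofReal_abs, ENNReal.ofReal_rpow_of_nonneg (abs_nonneg _) (by linarith)]

lemma memLp_of_assumptionA4_of_le [IsProbabilityMeasure P] (hq : 4 ≤ q) (hε : IIDErrors P ε) (h4 : AssumptionA4 P q ε)
    {r : ℝ} (hr : r ≤ 2 * q) (i : ℕ) : MemLp (ε i) (ENNReal.ofReal r) P :=
  (hε.identDistrib i).memLp_iff.2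
    ((memLp_of_assumptionA4 hq hε h4).mono_exponent (ENNReal.ofReal_le_ofReal hr))

/-- Union bound and Markov's inequality of order `q` for the maximal error. -/
lemma measure_exists_error_gt_le [IsProbabilityMeasure P] (hq : 4 ≤ q) (hε : IIDErrors P ε) (h4 : AssumptionA4 P q ε)
    (n : ℕ) {t : ℝ} (ht : 0 < t) :
    P {ω | ∃ i < n, t < |ε i ω|} ≤
      ENNReal.ofReal (n * ((∫ ω, |ε 0 ω| ^ q ∂P) / t ^ q)) := by
  have hq0 : 0 < q := by linarith
  have hint : Integrable (fun ω => |ε 0 ω| ^ q) P := by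
    have h := (memLp_of_assumptionA4_of_le hq hε h4 (r := q) (by linarith) 0).integrable_norm_rpow
      (by simp; linarith) ENNReal.ofReal_ne_top
    simpa only [ENNReal.toReal_ofReal hq0.le, Real.norm_eq_abs] using h
  have hone : ∀ i, P {ω | t < |ε i ω|} ≤ ENNReal.ofReal ((∫ ω, |ε 0 ω| ^ q ∂P) / t ^ q) := by
    intro i
    have hid : P {ω | t < |ε i ω|} = P {ω | t < |ε 0 ω|} :=
      (hε.identDistrib i).measure_mem_eq (s := {x | t < |x|})
        (measurableSet_lt measurable_const measurable_id.abs)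
    have hM := mul_meas_ge_le_integral_of_nonneg
      (Eventually.of_forall fun ω => Real.rpow_nonneg (abs_nonneg (ε 0 ω)) q) hint (t ^ q)
    have htq : 0 < t ^ q := Real.rpow_pos_of_pos ht q
    rw [hid]
    calc P {ω | t < |ε 0 ω|} ≤ P {ω | t ^ q ≤ |ε 0 ω| ^ q} :=
          measure_mono fun ω hω => Real.rpow_le_rpow ht.le (le_of_lt hω) hq0.le
      _ = ENNReal.ofReal (P.real {ω | t ^ q ≤ |ε 0 ω| ^ q}) := by rw [ofReal_measureReal]
      _ ≤ _ := ENNReal.ofReal_le_ofReal (by rw [le_div_iff₀ htq, mul_comm]; exact hM)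
  calc P {ω | ∃ i < n, t < |ε i ω|} = P (⋃ i ∈ Finset.range n, {ω | t < |ε i ω|}) := by
        congr 1
        ext ω
        simp
    _ ≤ ∑ i ∈ Finset.range n, P {ω | t < |ε i ω|} := measure_biUnion_finset_le _ _
    _ ≤ ∑ _i ∈ Finset.range n, ENNReal.ofReal ((∫ ω, |ε 0 ω| ^ q ∂P) / t ^ q) :=
        Finset.sum_le_sum fun i _ => hone i
    _ = _ := by
        rw [Finset.sum_const, Finset.card_range, nsmul_eq_mul,
          ENNReal.ofReal_mul (Nat.cast_nonneg n), ENNReal.ofReal_natCast]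

lemma integral_error (hε : IIDErrors P ε) (i : ℕ) : ∫ ω, ε i ω ∂P = 0 := by
  rw [(hε.identDistrib i).integral_eq, hε.mean_zero]

lemma integral_error_mul_self (hε : IIDErrors P ε) (i : ℕ) :
    ∫ ω, ε i ω * ε i ω ∂P = ∫ ω, ε 0 ω ^ 2 ∂P := by
  simp_rw [← pow_two]
  exact ((hε.identDistrib i).comp (u := fun x : ℝ => x ^ 2)
    (measurable_id.pow_const 2)).integral_eq

lemma measure_norm_sum_error_gt_le [IsProbabilityMeasure P] (hε : IIDErrors P ε) {H : Type*} [NormedAddCommGroup H]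
    [InnerProductSpace ℝ H] (s : Finset ℕ) (v : ℕ → H) {t : ℝ} (ht : 0 < t) :
    P {ω | t < ‖∑ i ∈ s, ε i ω • v i‖} ≤
      ENNReal.ofReal ((∫ ω, ε 0 ω ^ 2 ∂P) * (∑ i ∈ s, ‖v i‖ ^ 2) / t ^ 2) := by
  have hL2 : ∀ i, MemLp (ε i) 2 P := fun i => (hε.identDistrib i).memLp_iff.2 hε.finite_variance
  refine measure_norm_sum_smul_gt_le s ε v hL2 (integral_error_mul_self hε) (fun i j hij => ?_) ht
  rw [(hε.indep.indepFun hij).integral_fun_mul_eq_mul_integral (hL2 i).1 (hL2 j).1,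
    integral_error hε, zero_mul]

/-- The centred squares of the errors are again independent with mean zero, and square integrable
thanks to the fourth moment, so the same Chebyshev bound applies. -/
lemma measure_norm_sum_sq_error_gt_le [IsProbabilityMeasure P] (hq : 4 ≤ q) (hε : IIDErrors P ε)
    (h4 : AssumptionA4 P q ε) {H : Type*} [NormedAddCommGroup H]
    [InnerProductSpace ℝ H] (s : Finset ℕ) (v : ℕ → H) {t : ℝ} (ht : 0 < t) :
    P {ω | t < ‖∑ i ∈ s, (ε i ω ^ 2 - ∫ ω, ε 0 ω ^ 2 ∂P) • v i‖} ≤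
      ENNReal.ofReal ((∫ ω, (ε 0 ω ^ 2 - ∫ ω, ε 0 ω ^ 2 ∂P) ^ 2 ∂P) *
        (∑ i ∈ s, ‖v i‖ ^ 2) / t ^ 2) := by
  set σ2 := ∫ ω, ε 0 ω ^ 2 ∂P with hσ2
  set u : ℝ → ℝ := fun x => x ^ 2 - σ2
  have hu : Measurable u := (measurable_id.pow_const 2).sub_const _
  have hL4 : ∀ i, MemLp (ε i) 4 P := fun i => by
    simpa using memLp_of_assumptionA4_of_le hq hε h4 (r := 4) (by linarith) i
  have hsq : ∀ i, MemLp (fun ω => ε i ω ^ 2) 2 P := fun i => by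
    have h : ENNReal.HolderTriple 4 4 2 := ⟨by
      rw [show (4 : ENNReal) = 2 * 2 by norm_num, ENNReal.mul_inv (by simp) (by simp), ← mul_add,
        ENNReal.inv_two_add_inv_two, mul_one]⟩
    simp_rw [pow_two]
    exact (hL4 i).mul (r := 2) (hL4 i)
  have hL2 : ∀ i, MemLp (fun ω => ε i ω ^ 2 - σ2) 2 P := fun i => (hsq i).sub (memLp_const _)
  have hid : ∀ i, IdentDistrib (fun ω => u (ε i ω)) (fun ω => u (ε 0 ω)) P P :=
    fun i => (hε.identDistrib i).comp hu
  have hmean : ∀ i, ∫ ω, u (ε i ω) ∂P = 0 := fun i => by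
    rw [(hid i).integral_eq]
    simp only [u]
    rw [integral_sub ((hsq 0).integrable (by norm_num)) (integrable_const _)]
    simp [hσ2]
  refine measure_norm_sum_smul_gt_le s (fun i ω => ε i ω ^ 2 - σ2) v hL2 (fun i => ?_)
    (fun i j hij => ?_) ht
  · simp_rw [← pow_two]
    exact ((hid i).comp (u := fun x : ℝ => x ^ 2) (measurable_id.pow_const 2)).integral_eq
  · have h := ((hε.indep.indepFun hij).comp hu hu).integral_fun_mul_eq_mul_integral
      (hL2 i).1 (hL2 j).1
    refine h.trans ?_
    rw [show ∫ ω, (u ∘ ε i) ω ∂P = 0 from hmean i, zero_mul]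

end Errors

end TwoSampleEL

/-! ### The matrix `V_n⁰`, the size of the design, and the change of signs. -/

namespace TwoSampleEL

variable {Ω : Type*} [MeasurableSpace Ω] {P : Measure Ω} {ε : ℕ → Ω → ℝ} {d : ℕ}

lemma covMatrix_zZero (hε : IIDErrors P ε) (X : ℕ → EuclideanSpace ℝ (Fin d)) (i : ℕ) :
    covMatrix P (fun ω => zZero X (fun m => ε m ω) i) =
      (∫ ω, ε 0 ω ^ 2 ∂P) • Matrix.vecMulVec (X i) (X i) := by
  ext s t
  have hself : cov[ε i, ε i; P] = ∫ ω, ε 0 ω ^ 2 ∂P := by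
    rw [covariance]
    simp only [integral_error hε i, sub_zero]
    exact integral_error_mul_self hε i
  simp only [covMatrix, zZero, Matrix.of_apply, PiLp.smul_apply, smul_eq_mul, Matrix.smul_apply,
    Matrix.vecMulVec_apply]
  rw [covariance_mul_const_left, covariance_mul_const_right]
  rw [show cov[fun ω => ε i ω, fun ω => ε i ω; P] = _ from hself, mul_assoc, mul_comm (X i t)]

lemma dotProduct_VZero_mulVec (hε : IIDErrors P ε) (n k : ℕ)
    (X : ℕ → EuclideanSpace ℝ (Fin d)) (u : EuclideanSpace ℝ (Fin d)) :
    u.ofLp ⬝ᵥ (VZero P n k X ε).mulVec u.ofLp =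
      (∫ ω, ε 0 ω ^ 2 ∂P) *
      (((n : ℝ) * ((k : ℝ) / n) ^ 2)⁻¹ * ∑ i ∈ Finset.range k, inner ℝ u (X i) ^ 2 +
      ((n : ℝ) * (1 - (k : ℝ) / n) ^ 2)⁻¹ * ∑ j ∈ Finset.Ico k n, inner ℝ u (X j) ^ 2) := by
  have hterm : ∀ i, u.ofLp ⬝ᵥ ((∫ ω, ε 0 ω ^ 2 ∂P) •
      Matrix.vecMulVec (X i).ofLp (X i).ofLp).mulVec u.ofLp =
      (∫ ω, ε 0 ω ^ 2 ∂P) * inner ℝ u (X i) ^ 2 := by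
    intro i
    have h : inner ℝ u (X i) = (X i).ofLp ⬝ᵥ u.ofLp := by
      simp [EuclideanSpace.inner_eq_star_dotProduct]
    rw [Matrix.smul_mulVec, dotProduct_smul, Matrix.vecMulVec_mulVec, h, smul_eq_mul]
    simp [dotProduct_comm, pow_two]
  simp only [VZero, covMatrix_zZero hε, Matrix.add_mulVec, Matrix.smul_mulVec _ (∑ _ ∈ _, _),
    Matrix.sum_mulVec, dotProduct_add, dotProduct_smul, dotProduct_sum, hterm, ← Finset.mul_sum,
    smul_eq_mul]
  ring

lemma isHermitian_VZero (hε : IIDErrors P ε) (n k : ℕ) (X : ℕ → EuclideanSpace ℝ (Fin d)) :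
    (VZero P n k X ε).IsHermitian := by
  ext s t
  simp [VZero, covMatrix_zZero hε, Matrix.vecMulVec_apply, Matrix.sum_apply, mul_comm]

/-- Subtracting `C` times the identity shifts the spectrum into the nonnegative reals, so the
difference is positive semidefinite. -/
lemma le_dotProduct_mulVec_of_spectrum {A : Matrix (Fin d) (Fin d) ℝ} (hA : A.IsHermitian)
    {C : ℝ} (hC : ∀ γ ∈ spectrum ℝ A, C ≤ γ) (u : EuclideanSpace ℝ (Fin d)) :
    C * ‖u‖ ^ 2 ≤ u.ofLp ⬝ᵥ A.mulVec u.ofLp := by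
  have hpsd : (A - algebraMap ℝ _ C).PosSemidef := by
    rw [Matrix.posSemidef_iff_isHermitian_and_spectrum_nonneg]
    refine ⟨hA.sub ?_, ?_⟩
    · rw [Matrix.algebraMap_eq_diagonal]
      exact Matrix.isHermitian_diagonal _
    · rw [← spectrum.sub_singleton_eq]
      rintro _ ⟨γ, hγ, _, rfl, rfl⟩
      exact sub_nonneg.2 (hC γ hγ)
  have h := hpsd.dotProduct_mulVec_nonneg u.ofLp
  rw [Matrix.sub_mulVec, dotProduct_sub, Algebra.algebraMap_eq_smul_one, Matrix.smul_mulVec,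
    Matrix.one_mulVec, dotProduct_smul] at h
  have hu : u.ofLp ⬝ᵥ u.ofLp = ‖u‖ ^ 2 := by
    rw [← real_inner_self_eq_norm_sq, EuclideanSpace.inner_eq_star_dotProduct, star_trivial]
  simp only [star_trivial, smul_eq_mul, hu] at h
  linarith

/-- A lower bound for the eigenvalues of `V_n⁰` bounds the design below. -/
lemma le_sum_inner_sq_of_spectrum (hε : IIDErrors P ε) {n k : ℕ} (hn : 0 < n) (hkn : k ≤ n)
    (X : ℕ → EuclideanSpace ℝ (Fin d)) {a C : ℝ} (ha : 0 < a) (hak : a ≤ (k : ℝ) / n)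
    (hka : (k : ℝ) / n ≤ 1 - a) (hC : ∀ γ ∈ spectrum ℝ (VZero P n k X ε), C ≤ γ)
    (u : EuclideanSpace ℝ (Fin d)) :
    a ^ 2 * n * C * ‖u‖ ^ 2 ≤
      (∫ ω, ε 0 ω ^ 2 ∂P) * ∑ i ∈ Finset.range n, inner ℝ u (X i) ^ 2 := by
  have hn' : (0 : ℝ) < n := by exact_mod_cast hn
  have h := le_dotProduct_mulVec_of_spectrum (isHermitian_VZero hε n k X) hC u
  rw [dotProduct_VZero_mulVec hε] at h
  -- Both phase weights are at most `1 / (n a ^ 2)`, so the two weighted sums merge into one sum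
  -- over all observations.
  have hw : ∀ x : ℝ, a ≤ x → (n * x ^ 2)⁻¹ ≤ (n * a ^ 2)⁻¹ := fun x hx => by gcongr
  have h1 := mul_le_mul_of_nonneg_right (hw _ hak)
    (Finset.sum_nonneg fun i (_ : i ∈ Finset.range k) => sq_nonneg (inner ℝ u (X i)))
  have h2 := mul_le_mul_of_nonneg_right (hw (1 - (k : ℝ) / n) (by linarith))
    (Finset.sum_nonneg fun i (_ : i ∈ Finset.Ico k n) => sq_nonneg (inner ℝ u (X i)))
  have hσ : 0 ≤ ∫ ω, ε 0 ω ^ 2 ∂P := integral_nonneg fun ω => sq_nonneg _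
  have h3 := h.trans (mul_le_mul_of_nonneg_left (add_le_add h1 h2) hσ)
  rw [← mul_add, Finset.sum_range_add_sum_Ico _ hkn] at h3
  calc a ^ 2 * n * C * ‖u‖ ^ 2 = (n * a ^ 2) * (C * ‖u‖ ^ 2) := by ring
    _ ≤ (n * a ^ 2) * _ := mul_le_mul_of_nonneg_left h3 (by positivity)
    _ = _ := by field_simp

/-- Coordinatewise `x ^ 2 ≤ 1 + |x| ^ q`. This turns the design condition into `‖X i‖ ^ 2 = O(p)`.
-/
lemma norm_sq_le_of_mean_rpow_lt {q C : ℝ} (hq : 2 ≤ q) (hd : d ≠ 0)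
    (x : EuclideanSpace ℝ (Fin d)) (hx : (d : ℝ)⁻¹ * ∑ s, |x s| ^ q < C) :
    ‖x‖ ^ 2 ≤ d * (1 + C) := by
  have hd' : (0 : ℝ) < d := by exact_mod_cast Nat.pos_of_ne_zero hd
  have hterm : ∀ s, ‖x s‖ ^ 2 ≤ 1 + |x s| ^ q := by
    intro s
    rw [Real.norm_eq_abs]
    rcases le_total |x s| 1 with h | h
    · have := Real.rpow_nonneg (abs_nonneg (x s)) q
      nlinarith [abs_nonneg (x s)]
    · have : |x s| ^ (2 : ℝ) ≤ |x s| ^ q := Real.rpow_le_rpow_of_exponent_le h hq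
      rw [Real.rpow_two] at this
      linarith
  rw [EuclideanSpace.norm_sq_eq]
  refine (Finset.sum_le_sum fun s _ => hterm s).trans ?_
  rw [inv_mul_lt_iff₀ hd'] at hx
  rw [Finset.sum_add_distrib]
  simp only [Finset.sum_const, Finset.card_univ, Fintype.card_fin, nsmul_eq_mul, mul_one]
  linarith

/-- Reduction of a Lagrange multiplier to a zero of the score with signs absorbed in the vectors. -/
lemma isLagrangeMultiplier_iff {n k : ℕ} (hkn : k ≤ n) (z : ℕ → EuclideanSpace ℝ (Fin d))
    (l : EuclideanSpace ℝ (Fin d)) :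
    IsLagrangeMultiplier n k z l ↔
      (∀ i ∈ Finset.range n, 0 < (if i < k then (k : ℝ) / n else 1 - (k : ℝ) / n)
        + inner ℝ l ((if i < k then (1 : ℝ) else -1) • z i)) ∧
      ∑ i ∈ Finset.range n, ((if i < k then (k : ℝ) / n else 1 - (k : ℝ) / n)
        + inner ℝ l ((if i < k then (1 : ℝ) else -1) • z i))⁻¹ •
          ((if i < k then (1 : ℝ) else -1) • z i) = 0 := by
  have hsum : ∑ i ∈ Finset.range n, ((if i < k then (k : ℝ) / n else 1 - (k : ℝ) / n)
        + inner ℝ l ((if i < k then (1 : ℝ) else -1) • z i))⁻¹ •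
          ((if i < k then (1 : ℝ) else -1) • z i) =
      ∑ i ∈ Finset.range k, ((k : ℝ) / n + inner ℝ l (z i))⁻¹ • z i
        - ∑ j ∈ Finset.Ico k n, (1 - (k : ℝ) / n - inner ℝ l (z j))⁻¹ • z j := by
    rw [← Finset.sum_range_add_sum_Ico _ hkn, sub_eq_add_neg (Finset.sum _ _), ← Finset.sum_neg_distrib]
    congr 1
    · refine Finset.sum_congr rfl fun i hi => ?_
      simp [Finset.mem_range.1 hi]
    · refine Finset.sum_congr rfl fun i hi => ?_
      simp [not_lt.2 (Finset.mem_Ico.1 hi).1, sub_eq_add_neg]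
  rw [hsum, IsLagrangeMultiplier, ← and_assoc]
  refine and_congr_left fun _ => ⟨fun h i hi => ?_, fun h => ⟨fun i hi => ?_, fun i hi => ?_⟩⟩
  · by_cases hik : i < k
    · simpa [hik] using h.1 i (Finset.mem_range.2 hik)
    · simpa [hik, sub_eq_add_neg] using
        h.2 i (Finset.mem_Ico.2 ⟨not_lt.1 hik, Finset.mem_range.1 hi⟩)
  · have hik := Finset.mem_range.1 hi
    simpa [hik] using h i (Finset.mem_range.2 (hik.trans_le hkn))
  · obtain ⟨h1, h2⟩ := Finset.mem_Ico.1 hi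
    simpa [not_lt.2 h1, sub_eq_add_neg] using h i (Finset.mem_range.2 h2)

end TwoSampleEL

/-! ### The deterministic criterion for a multiplier, and the growth conditions in terms of `n`. -/

namespace TwoSampleEL

open scoped TensorProduct in
/-- If the errors, the score at zero and the sample covariance are under control, the Lagrange
multiplier exists, is unique, and lies in the ball of radius `r`. -/
lemma existsUnique_isLagrangeMultiplier_of_bounds {d n k : ℕ} (hkn : k ≤ n)
    (X z : ℕ → EuclideanSpace ℝ (Fin d)) (e : ℕ → ℝ) (hz : ∀ i < n, z i = e i • X i)
    {a c σ2 r τ L B : ℝ} (ha : 0 < a) (hak : a ≤ (k : ℝ) / n) (hka : (k : ℝ) / n ≤ 1 - a)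
    (hc : 0 < c) (hr : 0 < r) (hτ : 0 ≤ τ)
    (hdesign : ∀ u, 2 * c * ‖u‖ ^ 2 ≤ σ2 * ∑ i ∈ Finset.range n, inner ℝ u (X i) ^ 2)
    (hL : ∀ i < n, ‖X i‖ ≤ L) (hsmall : r * (τ * L) ≤ a / 2) (hBr : 2 * B < c * r)
    (he : ∀ i < n, |e i| ≤ τ)
    (hB : ‖∑ i ∈ Finset.range n, e i • (if i < k then (k : ℝ) / n else 1 - (k : ℝ) / n)⁻¹ •
      (if i < k then (1 : ℝ) else -1) • X i‖ ≤ B)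
    (hcov : ‖∑ i ∈ Finset.range n, (e i ^ 2 - σ2) • (X i ⊗ₜ[ℝ] X i)‖ ≤ c) :
    (∃! l, IsLagrangeMultiplier n k z l) ∧ ∀ l, IsLagrangeMultiplier n k z l → ‖l‖ ≤ r := by
  set t : ℕ → ℝ := fun i => if i < k then (k : ℝ) / n else 1 - (k : ℝ) / n with ht
  set y : ℕ → EuclideanSpace ℝ (Fin d) := fun i => (if i < k then (1 : ℝ) else -1) • z i with hy
  have hiff : ∀ l, IsLagrangeMultiplier n k z l ↔
      (∀ i ∈ Finset.range n, 0 < t i + inner ℝ l (y i)) ∧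
      ∑ i ∈ Finset.range n, (t i + inner ℝ l (y i))⁻¹ • y i = 0 :=
    fun l => isLagrangeMultiplier_iff hkn z l
  have hta : ∀ i ∈ Finset.range n, a ≤ t i := fun i _ => by
    simp only [ht]
    split_ifs <;> linarith
  have ht1 : ∀ i ∈ Finset.range n, t i ≤ 1 := fun i _ => by
    simp only [ht]
    split_ifs <;> linarith
  have hinner : ∀ u, ∀ i ∈ Finset.range n,
      inner ℝ u (y i) ^ 2 = e i ^ 2 * inner ℝ u (X i) ^ 2 := by
    intro u i hi
    simp only [hy, hz i (Finset.mem_range.1 hi)]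
    split_ifs <;> simp only [inner_smul_right] <;> ring
  have hynorm : ∀ i ∈ Finset.range n, r * ‖y i‖ ≤ a / 2 := by
    intro i hi
    have hi' := Finset.mem_range.1 hi
    have h1 : ‖y i‖ = |e i| * ‖X i‖ := by
      simp only [hy, hz i hi']
      split_ifs <;> simp [norm_smul]
    rw [h1]
    exact (mul_le_mul_of_nonneg_left
      (mul_le_mul (he i hi') (hL i hi') (norm_nonneg _) hτ) hr.le).trans hsmall
  have hyB : ‖∑ i ∈ Finset.range n, (t i)⁻¹ • y i‖ ≤ B := by
    convert hB using 2
    refine Finset.sum_congr rfl fun i hi => ?_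
    simp only [hy, hz i (Finset.mem_range.1 hi)]
    simp only [smul_smul]
    congr 1
    ring
  have hspan : ∀ u, c * ‖u‖ ^ 2 ≤ ∑ i ∈ Finset.range n, inner ℝ u (y i) ^ 2 := by
    intro u
    -- The fluctuation of the quadratic form is linear in `u ⊗ u`, whose norm is `‖u‖ ^ 2`.
    -- Cauchy–Schwarz in the tensor square then bounds it for all `u` at once, losing half of the
    -- design bound `2 c`.
    have h1 : inner ℝ (u ⊗ₜ[ℝ] u) (∑ i ∈ Finset.range n, (e i ^ 2 - σ2) • (X i ⊗ₜ[ℝ] X i)) =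
        ∑ i ∈ Finset.range n, inner ℝ u (y i) ^ 2
          - σ2 * ∑ i ∈ Finset.range n, inner ℝ u (X i) ^ 2 := by
      rw [inner_sum, Finset.mul_sum, ← Finset.sum_sub_distrib]
      refine Finset.sum_congr rfl fun i hi => ?_
      refine (inner_smul_right (𝕜 := ℝ) (u ⊗ₜ[ℝ] u) (X i ⊗ₜ[ℝ] X i) (e i ^ 2 - σ2)).trans ?_
      rw [hinner u i hi, TensorProduct.inner_tmul]
      ring
    have h2 := (abs_le.1 (abs_real_inner_le_norm (u ⊗ₜ[ℝ] u)
      (∑ i ∈ Finset.range n, (e i ^ 2 - σ2) • (X i ⊗ₜ[ℝ] X i)))).1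
    rw [h1, TensorProduct.norm_tmul] at h2
    have h3 := mul_le_mul_of_nonneg_left hcov (mul_self_nonneg ‖u‖)
    have h4 := hdesign u
    nlinarith
  obtain ⟨l, hlr, hl⟩ := exists_score_zero (Finset.range n) y t ha hta ht1 hynorm hyB hspan hr hBr
  have huniq : ∀ m, IsLagrangeMultiplier n k z m → m = l := fun m hm =>
    score_zero_unique (Finset.range n) y t hc hspan ((hiff m).1 hm).1 hl.1 ((hiff m).1 hm).2 hl.2
  exact ⟨⟨l, (hiff l).2 hl, huniq⟩, fun m hm => by rwa [huniq m hm]⟩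

variable {p k : ℕ → ℕ} {q : ℝ}

/-- The exponent is nonpositive and `k ≤ n`, so replacing `k` by `n` only decreases the power. -/
lemma tendsto_mul_rpow_of_assumptionA5 (hq : 2 ≤ q) (hk : ∀ᶠ n in atTop, 0 < k n ∧ k n ≤ n)
    (h5 : AssumptionA5 q p k) :
    Tendsto (fun n : ℕ => (p n : ℝ) * (n : ℝ) ^ ((2 - q) / (2 * q))) atTop (𝓝 0) := by
  refine squeeze_zero' (Eventually.of_forall fun n => by positivity) ?_ h5.1
  filter_upwards [hk] with n hn
  refine mul_le_mul_of_nonneg_left ?_ (Nat.cast_nonneg _)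
  exact Real.rpow_le_rpow_of_nonpos (by exact_mod_cast hn.1) (by exact_mod_cast hn.2)
    (div_nonpos_of_nonpos_of_nonneg (by linarith) (by linarith))

lemma tendsto_sq_div_of_assumptionA6 (hq : 0 < q) (hk : ∀ᶠ n in atTop, 0 < k n ∧ k n ≤ n)
    (h6 : AssumptionA6 q p k) :
    Tendsto (fun n : ℕ => (p n : ℝ) ^ 2 / (n : ℝ)) atTop (𝓝 0) := by
  refine squeeze_zero' (Eventually.of_forall fun n => by positivity) ?_ h6.1
  filter_upwards [hk] with n hn
  rw [div_eq_mul_inv]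
  have h1 : (0 : ℝ) < k n := by exact_mod_cast hn.1
  have h2 : (k n : ℝ) ≤ n := by exact_mod_cast hn.2
  refine mul_le_mul ?_ (inv_anti₀ h1 h2) (by positivity) (by positivity)
  -- Comparing the exponents `2` and `2 + 4 / q` requires a base at least `1`.
  rcases Nat.eq_zero_or_pos (p n) with h0 | h0
  · rw [h0]
    simp only [Nat.cast_zero, ne_eq, OfNat.ofNat_ne_zero, not_false_eq_true, zero_pow]
    positivity
  · rw [← Real.rpow_two]
    exact Real.rpow_le_rpow_of_exponent_le (by exact_mod_cast h0)
      (by linarith [div_pos four_pos hq])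

/-- For a threshold `x` of order `√n / p`, the union bound `n x ^ (-q)` is exactly a constant times
the `q`-th power of the quantity in (A5). -/
lemma rpow_mul_div_rpow_eq {q n x p M b : ℝ} (hq : 0 < q) (hn : 0 < n) (hp : 0 < p) (hM : 0 < M)
    (hb : 0 < b) (hx : x = b * √n / (M * p)) :
    n * x ^ (-q) = (M / b) ^ q * (p * n ^ ((2 - q) / (2 * q))) ^ q := by
  have hs : (√n) ^ (-q) = n ^ (-q / 2) := by
    rw [Real.sqrt_eq_rpow, ← Real.rpow_mul hn.le]
    congr 1
    ring
  have hnq : (n ^ ((2 - q) / (2 * q))) ^ q = n * n ^ (-q / 2) := by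
    rw [← Real.rpow_mul hn.le]
    nth_rewrite 2 [← Real.rpow_one n]
    rw [← Real.rpow_add hn]
    congr 1
    field_simp
    ring
  have hx' : x = (M / b * p)⁻¹ * √n := by
    rw [hx]
    field_simp
  rw [hx', Real.mul_rpow (by positivity) (by positivity), hs, Real.inv_rpow (by positivity),
    Real.rpow_neg (by positivity), inv_inv, Real.mul_rpow (by positivity) (by positivity),
    Real.mul_rpow (by positivity) (by positivity), hnq]
  ring

end TwoSampleEL

/-! ### Probability of the good event. -/

namespace TwoSampleEL

variable {Ω : Type*} [MeasurableSpace Ω] {P : Measure Ω} {ε : ℕ → Ω → ℝ}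

/-- Dimension zero is separate: the target radius is then `0`, while the general argument needs a
ball of positive radius. -/
lemma existsUnique_isLagrangeMultiplier_of_dim_zero {d n k : ℕ} (hd : d = 0)
    (z : ℕ → EuclideanSpace ℝ (Fin d)) (h0 : 0 < (k : ℝ) / n) (h1 : (k : ℝ) / n < 1) {r : ℝ}
    (hr : 0 ≤ r) :
    (∃! l, IsLagrangeMultiplier n k z l) ∧ ∀ l, IsLagrangeMultiplier n k z l → ‖l‖ ≤ r := by
  subst hd
  refine ⟨⟨0, ⟨fun i _ => ?_, fun j _ => ?_, Subsingleton.elim _ _⟩,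
    fun m _ => Subsingleton.elim _ _⟩, fun l _ => ?_⟩
  · simpa using h0
  · simpa using h1
  · rw [Subsingleton.elim l 0, norm_zero]
    exact hr

/-- The inverse-probability weighted score at zero is `O_P(√(n p))`. -/
lemma measure_score_zero_gt_le [IsProbabilityMeasure P] (hε : IIDErrors P ε) {d n k : ℕ}
    (X : ℕ → EuclideanSpace ℝ (Fin d)) {a L B : ℝ} (ha : 0 < a) (hak : a ≤ (k : ℝ) / n)
    (hka : (k : ℝ) / n ≤ 1 - a) (hL : ∀ i < n, ‖X i‖ ^ 2 ≤ L) (hB : 0 < B) :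
    P {ω | B < ‖∑ i ∈ Finset.range n,
      ε i ω • (if i < k then (k : ℝ) / n else 1 - (k : ℝ) / n)⁻¹ •
        (if i < k then (1 : ℝ) else -1) • X i‖} ≤
      ENNReal.ofReal ((∫ ω, ε 0 ω ^ 2 ∂P) * (n * L / a ^ 2) / B ^ 2) := by
  refine (measure_norm_sum_error_gt_le hε (Finset.range n) _ hB).trans
    (ENNReal.ofReal_le_ofReal ?_)
  have hσ : 0 ≤ ∫ ω, ε 0 ω ^ 2 ∂P := integral_nonneg fun ω => sq_nonneg _
  have hsum : ∑ i ∈ Finset.range n, ‖(if i < k then (k : ℝ) / n else 1 - (k : ℝ) / n)⁻¹ •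
      (if i < k then (1 : ℝ) else -1) • X i‖ ^ 2 ≤ ∑ _i ∈ Finset.range n, L / a ^ 2 := by
    refine Finset.sum_le_sum fun i hi => ?_
    have h1 : a ≤ if i < k then (k : ℝ) / n else 1 - (k : ℝ) / n := by
      split_ifs <;> linarith
    have h2 : ‖(if i < k then (1 : ℝ) else -1) • X i‖ = ‖X i‖ := by
      split_ifs <;> simp
    rw [norm_smul, h2, norm_inv, Real.norm_of_nonneg (ha.le.trans h1), mul_pow, inv_pow,
      inv_mul_eq_div]
    have := hL i (Finset.mem_range.1 hi)
    gcongr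
    exact (sq_nonneg _).trans this
  rw [Finset.sum_const, Finset.card_range, nsmul_eq_mul, ← mul_div_assoc] at hsum
  gcongr

open scoped TensorProduct in
/-- Concentration of the sample covariance, in Hilbert-Schmidt norm. -/
lemma measure_sample_covariance_gt_le [IsProbabilityMeasure P] {q : ℝ} (hq : 4 ≤ q)
    (hε : IIDErrors P ε) (h4 : AssumptionA4 P q ε) {d n : ℕ}
    (X : ℕ → EuclideanSpace ℝ (Fin d)) {c L : ℝ} (hL : ∀ i < n, ‖X i‖ ^ 2 ≤ L) (hc : 0 < c) :
    P {ω | c < ‖∑ i ∈ Finset.range n,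
      (ε i ω ^ 2 - ∫ ω, ε 0 ω ^ 2 ∂P) • (X i ⊗ₜ[ℝ] X i)‖} ≤
      ENNReal.ofReal ((∫ ω, (ε 0 ω ^ 2 - ∫ ω, ε 0 ω ^ 2 ∂P) ^ 2 ∂P) * (n * L ^ 2) / c ^ 2) := by
  refine (measure_norm_sum_sq_error_gt_le hq hε h4 (Finset.range n) _ hc).trans
    (ENNReal.ofReal_le_ofReal ?_)
  have hσ : 0 ≤ ∫ ω, (ε 0 ω ^ 2 - ∫ ω, ε 0 ω ^ 2 ∂P) ^ 2 ∂P :=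
    integral_nonneg fun ω => sq_nonneg _
  have hsum : ∑ i ∈ Finset.range n, ‖X i ⊗ₜ[ℝ] X i‖ ^ 2 ≤ ∑ _i ∈ Finset.range n, L ^ 2 := by
    refine Finset.sum_le_sum fun i hi => ?_
    rw [TensorProduct.norm_tmul, ← pow_two]
    exact pow_le_pow_left₀ (sq_nonneg _) (hL i (Finset.mem_range.1 hi)) 2
  rw [Finset.sum_const, Finset.card_range, nsmul_eq_mul] at hsum
  gcongr

/-- Explains the truncation level of the errors: it is the one for which radius, error bound and
design bound multiply to exactly `a / 2`. -/
lemma radius_mul_error_mul_design {M a K n p : ℝ} (hn : 0 < n) (hp : 0 < p) (hM : 0 < M)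
    (hK : 0 < K) :
    M * (√p / √n) * (a * √n / (2 * M * √K * p) * √(p * K)) = a / 2 := by
  rw [Real.sqrt_mul hp.le]
  have h := Real.sqrt_pos.2 hn
  have h' := Real.sqrt_pos.2 hK
  calc M * (√p / √n) * (a * √n / (2 * M * √K * p) * (√p * √K))
      = a * (√p * √p) / (2 * p) := by field_simp
    _ = a / 2 := by
        rw [Real.mul_self_sqrt hp.le]
        field_simp

lemma exists_measure_le_forall_notMem_le {f : Ω → ℝ} {b c δ : ℝ}
    (h : P {ω | b < f ω} ≤ ENNReal.ofReal c) (hc : c ≤ δ) :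
    ∃ E, P E ≤ ENNReal.ofReal δ ∧ ∀ ω ∉ E, f ω ≤ b :=
  ⟨_, h.trans (ENNReal.ofReal_le_ofReal hc), fun _ hω => not_lt.1 fun hlt => hω hlt⟩

/-- With probability arbitrarily close to one, the Lagrange multiplier exists, is unique, and is of
norm at most a multiple of `√(p / n)`. -/
theorem exists_eventually_measure_not_existsUnique_le [IsProbabilityMeasure P]
    {q : ℝ} (hq : 4 ≤ q) {p k : ℕ → ℕ} {θ₀ : ℝ} (hθ₀ : θ₀ ∈ Set.Ioo (0 : ℝ) 1)
    (hk : Tendsto (fun n : ℕ => (k n : ℝ) / n) atTop (𝓝 θ₀))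
    (X : (n : ℕ) → ℕ → EuclideanSpace ℝ (Fin (p n))) (hε : IIDErrors P ε)
    (z : (n : ℕ) → Ω → ℕ → EuclideanSpace ℝ (Fin (p n)))
    (hz : ∀ n ω, ∀ i < n, z n ω i = ε i ω • X n i)
    (hA1 : AssumptionA1 P p k X ε) (hA3 : AssumptionA3 q p X) (hA4 : AssumptionA4 P q ε)
    (hA5 : AssumptionA5 q p k) (hA6 : AssumptionA6 q p k) {δ : ℝ} (hδ : 0 < δ) :
    ∃ M : ℝ, 0 < M ∧ ∀ᶠ n in atTop,
      P {ω | ¬ ((∃! l, IsLagrangeMultiplier n (k n) (z n ω) l) ∧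
        ∀ l, IsLagrangeMultiplier n (k n) (z n ω) l →
          ‖l‖ ≤ M * ((p n : ℝ) ^ (1 / 2 : ℝ) * (n : ℝ) ^ (-(1 / 2) : ℝ)))} ≤ ENNReal.ofReal δ := by
  obtain ⟨C₀, C₁, hC₀, -, hV⟩ := hA1
  obtain ⟨C₃, hC₃, hX⟩ := hA3
  set σ2 : ℝ := ∫ ω, ε 0 ω ^ 2 ∂P
  have hσ : 0 ≤ σ2 := integral_nonneg fun ω => sq_nonneg _
  set κ : ℝ := ∫ ω, (ε 0 ω ^ 2 - σ2) ^ 2 ∂P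
  set m : ℝ := ∫ ω, |ε 0 ω| ^ q ∂P
  obtain ⟨a, ha, ha1, ha2⟩ : ∃ a : ℝ, 0 < a ∧ a < θ₀ ∧ θ₀ < 1 - a :=
    ⟨min θ₀ (1 - θ₀) / 2, by
      have := lt_min hθ₀.1 (sub_pos.2 hθ₀.2)
      linarith, by
      have := lt_min hθ₀.1 (sub_pos.2 hθ₀.2)
      linarith [min_le_left θ₀ (1 - θ₀)], by
      have := lt_min hθ₀.1 (sub_pos.2 hθ₀.2)
      linarith [min_le_right θ₀ (1 - θ₀)]⟩
  have hka : ∀ᶠ n : ℕ in atTop, 0 < k n ∧ k n ≤ n ∧ a ≤ (k n : ℝ) / n ∧ (k n : ℝ) / n ≤ 1 - a := by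
    filter_upwards [hk.eventually_const_lt ha1, hk.eventually_lt_const ha2, eventually_gt_atTop 0]
      with n h1 h2 h3
    have hn : (0 : ℝ) < n := by exact_mod_cast h3
    have h4 : (0 : ℝ) < k n := by
      rw [lt_div_iff₀ hn] at h1
      exact (mul_pos ha hn).trans h1
    have h5 : (k n : ℝ) ≤ n := by
      rw [div_lt_iff₀ hn] at h2
      nlinarith
    exact ⟨by exact_mod_cast h4, by exact_mod_cast h5, h1.le, h2.le⟩
  have hkn : ∀ᶠ n in atTop, 0 < k n ∧ k n ≤ n := hka.mono fun n h => ⟨h.1, h.2.1⟩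
  set K : ℝ := 1 + C₃
  have hK : 0 < K := by positivity
  -- Half of the lower bound for the mean quadratic form per observation; the other half absorbs the
  -- fluctuation.
  set c : ℝ := a ^ 2 * C₀ / 2 with hc_def
  have hc : 0 < c := by positivity
  -- With `B = c n r / 4`, Chebyshev bounds the score event by `16 σ² K / (a ^ 2 c ^ 2 M ^ 2)`,
  -- which is at most `δ / 2` once `A ≤ M ^ 2`. Taking `M = A + 1` ensures this.
  set A : ℝ := 32 * σ2 * K / (a ^ 2 * c ^ 2 * δ) with hA_def
  have hA : 0 ≤ A := by positivity
  set M : ℝ := A + 1 with hM_def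
  have hM : 0 < M := by positivity
  have hAM : A ≤ M ^ 2 := by nlinarith
  refine ⟨M, hM, ?_⟩
  have hlim1 : Tendsto (fun n : ℕ => m * ((2 * M * √K / a) ^ q *
      ((p n : ℝ) * (n : ℝ) ^ ((2 - q) / (2 * q))) ^ q)) atTop (𝓝 0) := by
    have h := (tendsto_mul_rpow_of_assumptionA5 (by linarith) hkn hA5).rpow_const
      (p := q) (Or.inr (by linarith))
    rw [Real.zero_rpow (by linarith)] at h
    simpa using (h.const_mul ((2 * M * √K / a) ^ q)).const_mul m
  have hlim2 : Tendsto (fun n : ℕ => κ * K ^ 2 / c ^ 2 * ((p n : ℝ) ^ 2 / (n : ℝ)))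
      atTop (𝓝 0) := by
    simpa using (tendsto_sq_div_of_assumptionA6 (by linarith) hkn hA6).const_mul (κ * K ^ 2 / c ^ 2)
  filter_upwards [hka, hV, hlim1.eventually_le_const (show (0 : ℝ) < δ / 4 by positivity),
    hlim2.eventually_le_const (show (0 : ℝ) < δ / 4 by positivity)]
    with n ⟨hk0, hkn, hak, hka⟩ hV h1 h2
  rcases Nat.eq_zero_or_pos (p n) with hp0 | hp0
  · refine (measure_mono (t := ∅) fun ω hω => ?_).trans (measure_empty.trans_le zero_le)
    rw [Set.mem_ofPred_eq] at hω
    exact hω (existsUnique_isLagrangeMultiplier_of_dim_zero hp0 _ (ha.trans_le hak) (by linarith)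
      (by positivity))
  have hn0 : 0 < n := hk0.trans_le hkn
  have hn : (0 : ℝ) < n := by exact_mod_cast hn0
  have hp : (0 : ℝ) < p n := by exact_mod_cast hp0
  set r : ℝ := M * ((p n : ℝ) ^ (1 / 2 : ℝ) * (n : ℝ) ^ (-(1 / 2) : ℝ)) with hr_def
  have hr_eq : r = M * (√(p n) / √n) := by
    rw [hr_def, Real.rpow_neg hn.le, ← Real.sqrt_eq_rpow, ← Real.sqrt_eq_rpow, div_eq_mul_inv]
  have hr : 0 < r := by positivity
  have hr_sq : r ^ 2 = M ^ 2 * (p n / n) := by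
    rw [hr_eq, mul_pow, div_pow, Real.sq_sqrt hp.le, Real.sq_sqrt hn.le]
  set τ : ℝ := a * √n / (2 * M * √K * p n) with hτ_def
  have hτ : 0 < τ := by positivity
  -- Any fraction of `c n r` below one half would satisfy the strict inequality `2 B < c n r`.
  set B : ℝ := c * n * r / 4 with hB_def
  have hB : 0 < B := by positivity
  have hXL : ∀ i < n, ‖X n i‖ ^ 2 ≤ p n * K := fun i hi =>
    norm_sq_le_of_mean_rpow_lt (by linarith) hp0.ne' _ (hX n i hi)
  have hb1 := measure_exists_error_gt_le hq hε hA4 n hτ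
  have hb2 := measure_score_zero_gt_le hε (X n) ha hak hka hXL hB
  have hb3 := measure_sample_covariance_gt_le hq hε hA4 (X n) hXL (mul_pos hc hn)
  have hm1 : n * (m / τ ^ q) ≤ δ / 4 := by
    refine le_trans (le_of_eq ?_) h1
    rw [← rpow_mul_div_rpow_eq (by linarith) hn hp (by positivity) ha hτ_def, Real.rpow_neg hτ.le]
    ring
  have hm2 : σ2 * (n * (p n * K) / a ^ 2) / B ^ 2 ≤ δ / 2 := by
    rw [hA_def, div_le_iff₀ (by positivity)] at hAM
    rw [div_le_iff₀ (by positivity), hB_def, div_pow, mul_pow, hr_sq, ← mul_div_assoc,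
      div_le_iff₀ (by positivity)]
    have h3 := mul_le_mul_of_nonneg_right hAM (show 0 ≤ (n : ℝ) * p n / 32 by positivity)
    refine le_trans (le_of_eq ?_) (h3.trans (le_of_eq ?_))
    · ring
    · field_simp
      ring
  have hm3 : κ * (n * (p n * K) ^ 2) / (c * n) ^ 2 ≤ δ / 4 := by
    refine le_trans (le_of_eq ?_) h2
    field_simp
  obtain ⟨E₁, hE₁, he₁⟩ : ∃ E, P E ≤ ENNReal.ofReal (δ / 4) ∧ ∀ ω ∉ E, ∀ i < n, |ε i ω| ≤ τ :=
    ⟨_, hb1.trans (ENNReal.ofReal_le_ofReal hm1), fun ω hω i hi =>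
      not_lt.1 fun h => hω ⟨i, hi, h⟩⟩
  obtain ⟨E₂, hE₂, he₂⟩ := exists_measure_le_forall_notMem_le hb2 hm2
  obtain ⟨E₃, hE₃, he₃⟩ := exists_measure_le_forall_notMem_le hb3 hm3
  calc
    P {ω | ¬ ((∃! l, IsLagrangeMultiplier n (k n) (z n ω) l) ∧
        ∀ l, IsLagrangeMultiplier n (k n) (z n ω) l → ‖l‖ ≤ r)} ≤ P ((E₁ ∪ E₂) ∪ E₃) := by
      refine measure_mono fun ω hω => ?_
      by_contra hcon
      simp only [Set.mem_union, not_or] at hcon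
      rw [Set.mem_ofPred_eq] at hω
      refine hω (existsUnique_isLagrangeMultiplier_of_bounds hkn (X n) (z n ω) (fun i => ε i ω)
        (hz n ω) (σ2 := σ2) (L := √(p n * K)) ha hak hka (mul_pos hc hn) hr hτ.le (fun u => ?_)
        (fun i hi => Real.le_sqrt_of_sq_le (hXL i hi)) ?_ ?_ (he₁ ω hcon.1.1) (he₂ ω hcon.1.2)
        (he₃ ω hcon.2))
      · have h := le_sum_inner_sq_of_spectrum hε hn0 hkn (X n) ha hak hka
          (fun γ hγ => (hV γ hγ).1.le) u
        refine le_trans (le_of_eq ?_) h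
        rw [hc_def]
        ring
      · refine le_of_eq ?_
        rw [hr_eq, hτ_def, radius_mul_error_mul_design hn hp hM hK]
      · rw [hB_def]
        have : 0 < c * n * r := by positivity
        linarith
    _ ≤ (ENNReal.ofReal (δ / 4) + ENNReal.ofReal (δ / 2)) + ENNReal.ofReal (δ / 4) :=
      (measure_union_le _ _).trans (add_le_add ((measure_union_le _ _).trans
        (add_le_add hE₁ hE₂)) hE₃)
    _ = ENNReal.ofReal δ := by
      rw [← ENNReal.ofReal_add (by positivity) (by positivity),
        ← ENNReal.ofReal_add (by positivity) (by positivity)]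
      congr 1
      ring

end TwoSampleEL

/-! ### The main theorem. -/

theorem proposition1 {Ω : Type*} [MeasurableSpace Ω] (P : Measure Ω) [IsProbabilityMeasure P]
    (q : ℝ) (hq : 4 ≤ q) (p k : ℕ → ℕ) (θ₀ : ℝ) (hθ₀ : θ₀ ∈ Set.Ioo (0 : ℝ) 1)
    (hk : Tendsto (fun n : ℕ => (k n : ℝ) / n) atTop (𝓝 θ₀))
    (X : (n : ℕ) → ℕ → EuclideanSpace ℝ (Fin (p n)))
    (β β₂ : (n : ℕ) → EuclideanSpace ℝ (Fin (p n)))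
    (ε : ℕ → Ω → ℝ) (hε : TwoSampleEL.IIDErrors P ε)
    (Y : ℕ → ℕ → Ω → ℝ)
    (hY : ∀ n, ∀ i < n, ∀ ω,
      Y n i ω = TwoSampleEL.response (k n) (X n) (β n) (β₂ n) (fun m => ε m ω) i)
    (hH0 : ∀ n, β₂ n = β n)
    (hA1 : TwoSampleEL.AssumptionA1 P p k X ε)
    (hA3 : TwoSampleEL.AssumptionA3 q p X)
    (hA4 : TwoSampleEL.AssumptionA4 P q ε)
    (hA5 : TwoSampleEL.AssumptionA5 q p k)
    (hA6 : TwoSampleEL.AssumptionA6 q p k) :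
    Tendsto (fun n => P {ω | ¬ ∃! l : EuclideanSpace ℝ (Fin (p n)),
        TwoSampleEL.IsLagrangeMultiplier n (k n)
          (TwoSampleEL.zVec (X n) (fun i => Y n i ω) (β n)) l}) atTop (𝓝 0) ∧
    ∀ lam : (n : ℕ) → Ω → EuclideanSpace ℝ (Fin (p n)),
      (∀ n ω, (∃ l : EuclideanSpace ℝ (Fin (p n)),
          TwoSampleEL.IsLagrangeMultiplier n (k n)
            (TwoSampleEL.zVec (X n) (fun i => Y n i ω) (β n)) l) →
        TwoSampleEL.IsLagrangeMultiplier n (k n)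
          (TwoSampleEL.zVec (X n) (fun i => Y n i ω) (β n)) (lam n ω)) →
      TwoSampleEL.IsBigOInProbability P (fun n ω => ‖lam n ω‖)
        (fun n => (p n : ℝ) ^ (1 / 2 : ℝ) * (n : ℝ) ^ (-(1 / 2) : ℝ)) := by
  -- Under the null hypothesis both phases share `β`, so the residuals at `β` are the errors
  -- themselves.
  have hz : ∀ n ω, ∀ i < n, TwoSampleEL.zVec (X n) (fun i => Y n i ω) (β n) i = ε i ω • X n i := by
    intro n ω i hi
    simp only [TwoSampleEL.zVec, hY n i hi ω, TwoSampleEL.response, hH0 n, ite_self,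
      add_sub_cancel_left]
  have key := fun (δ : ℝ) (hδ : 0 < δ) =>
    TwoSampleEL.exists_eventually_measure_not_existsUnique_le hq hθ₀ hk X hε
      (fun n ω => TwoSampleEL.zVec (X n) (fun i => Y n i ω) (β n)) hz hA1 hA3 hA4 hA5 hA6 hδ
  refine ⟨?_, fun lam hlam δ hδ => ?_⟩
  · rw [ENNReal.tendsto_nhds_zero]
    intro η hη
    obtain ⟨δ, hδ, hδη⟩ : ∃ δ : ℝ, 0 < δ ∧ ENNReal.ofReal δ ≤ η := by
      obtain ⟨δ, hδ, h⟩ := ENNReal.lt_iff_exists_nnreal_btwn.1 hη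
      exact ⟨δ, by simpa using hδ, by simpa using h.le⟩
    obtain ⟨M, -, h⟩ := key δ hδ
    filter_upwards [h] with n hn
    refine (measure_mono fun ω hω => ?_).trans (hn.trans hδη)
    rw [Set.mem_ofPred_eq] at hω ⊢
    exact fun hgood => hω hgood.1
  · obtain ⟨M, hM, h⟩ := key δ hδ
    refine ⟨M, hM, ?_⟩
    filter_upwards [h] with n hn
    refine (measure_mono fun ω hω => ?_).trans hn
    simp only [Set.mem_ofPred_eq, abs_norm] at hω ⊢
    -- On the good event a multiplier exists, so `lam n ω` is one and obeys the bound; its arbitrary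
    -- values elsewhere lie in the exceptional event.
    exact fun hgood => absurd (hgood.2 _ (hlam n ω hgood.1.exists)) (not_le.2 hω)
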